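/- Let $T$ be a finite rooted ordered tree with $n_T\ge 2$ nodes, labeled from a finite alphabet of size $\sigma\ge 2$. The \emph{top tree} $\mathcal T$ of $T$ is the ordered labeled binary tree built by the following greedy construction. Maintain a rooted ordered tree $\widetilde T$, initially $\widetilde T=T$, each edge of which stands for a root of a forest of binary trees; initially the edge from a node to its parent stands for a single leaf, labeled by the pair (label of the parent, label of the child). Merging two edges of $\widetilde T$ that share a node replaces them by one edge, which stands for a new binary node whose left and right child are what the two merged edges stood for, the edge that comes first in preorder giving the left child; the new node is labeled by the type of the merge. Merges are of five types: a \emph{vertical} merge of $(v,w)$ with the edge $(u,v)$ above it, where $w$ is the only child of $v$, gives the edge $(u,w)$, and it has one of two types according to whether $w$ is a leaf of $\widetilde T$; a \emph{horizontal} merge of the edges from $v$ to two consecutive children, at least one of which is a leaf of $\widetilde T$, gives an edge from $v$ to the non-leaf child if there is one and to a leaf otherwise, and it has one of three types according to whether only the left child, only the right child, or neither of them is a non-leaf. As long as $\widetilde T$ has more than one edge, perform the following iteration. Step 1 (horizontal merges). For each node $v$ with $k\ge2$ children $v_1,\dots,v_k$ from left to right and $i=1,\dots,\lfloor k/2\rfloor$,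 merge $(v,v_{2i-1})$ and $(v,v_{2i})$ if $v_{2i-1}$ or $v_{2i}$ is a leaf; if $k$ is odd, $v_k$ is a leaf and $v_{k-2},v_{k-1}$ are non-leaves, also merge $(v,v_{k-1})$ and $(v,v_k)$. Step 2 (vertical merges). For each path $v_1,\dots,v_p$ such that $v_{i+1}$ is the parent of $v_i$ and $v_2,\dots,v_{p-1}$ have a single child, and which is maximal with this property in $\widetilde T$ as it was at the beginning of the iteration: if $p$ is even, merge the pairs of edges $\{(v_1,v_2),(v_2,v_3)\},\{(v_3,v_4),(v_4,v_5)\},\dots,\{(v_{p-3},v_{p-2}),(v_{p-2},v_{p-1})\}$; if $p$ is odd, merge $\{(v_1,v_2),(v_2,v_3)\},\dots,\{(v_{p-4},v_{p-3}),(v_{p-3},v_{p-2})\}$ and, if $(v_{p-1},v_p)$ was not merged in Step 1, also $\{(v_{p-2},v_{p-1}),(v_{p-1},v_p)\}$. The construction ends with $\widetilde T$ a single edge, and $\mathcal T$ is the binary tree this edge stands for. The \emph{top DAG} $\mathcal{TD}$ is the minimal DAG of $\mathcal T$: its vertices are the distinct rooted subtrees of $\mathcal T$, and each vertex that is not a single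 leaf has one edge to its left and one to its right child subtree. Let $n_{\mathcal{TD}}$ be its number of vertices plus its number of edges. Then $$n_{\mathcal{TD}}=O\!\left(\frac{n_T}{(\log_\sigma n_T)^{0.19}}\right),$$ where the constant is absolute (independent of $T$ and of $\sigma$). -/

import Mathlib

/-- Finite rooted ordered trees whose nodes carry labels from `α`. -/
inductive OTree (α : Type*) where
  | node (label : α) (children : List (OTree α)) : OTree α

namespace OTree

mutual
/-- The number of nodes of a tree. -/
def numNodes {α : Type*} : OTree α → ℕ
  | node _ ts => 1 + numNodesForest ts
/-- The number of nodes of an ordered forest. -/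
def numNodesForest {α : Type*} : List (OTree α) → ℕ
  | [] => 0
  | t :: ts => numNodes t + numNodesForest ts
end

mutual
/-- Apply a function to all labels of a tree. -/
def mapLabels {α β : Type*} (f : α → β) : OTree α → OTree β
  | node a ts => node (f a) (mapLabelsForest f ts)
/-- Apply a function to all labels of an ordered forest. -/
def mapLabelsForest {α β : Type*} (f : α → β) : List (OTree α) → List (OTree β)
  | [] => []
  | t :: ts => mapLabels f t :: mapLabelsForest f ts
end

/-- The root has no children. -/
def isLeaf {α : Type*} : OTree α → Bool
  | node _ ts => ts.isEmpty

end OTree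

/-- The five ways of merging two clusters `A` (left) and `B` (right). -/
inductive MergeType where
  /-- `A` above `B`, and `B` has a bottom boundary node. -/
  | verticalBottom : MergeType
  /-- `A` above `B`, and `B` has no bottom boundary node. -/
  | verticalNoBottom : MergeType
  /-- Common top boundary node; only `A` has a bottom boundary node. -/
  | horizontalLeft : MergeType
  /-- Common top boundary node; only `B` has a bottom boundary node. -/
  | horizontalRight : MergeType
  /-- Common top boundary node; neither cluster has a bottom boundary node. -/
  | horizontalNone : MergeType
  deriving DecidableEq

/-- The ordered labeled binary trees that occur as (subtrees of) top trees. A leaf is an edge of the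
input tree, labeled by the label of the parent and the label of the child, in this order; an
internal node is labeled by the type of the merge; its left child is the cluster that comes first in
preorder. -/
inductive TopTree (α : Type*) where
  | edge (parent child : α) : TopTree α
  | merge (type : MergeType) (left right : TopTree α) : TopTree α
  deriving DecidableEq

namespace TopTree

/-- The set of distinct rooted subtrees. -/
def subtrees {α : Type*} [DecidableEq α] : TopTree α → Finset (TopTree α)
  | edge a b => {edge a b}
  | merge m l r => insert (merge m l r) (subtrees l ∪ subtrees r)

/-- The outgoing edges of a vertex in the minimal DAG. They are ordered: `false` marks the edge to
the left child, `true` the edge to the right child (the two may have the same target). -/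
def outEdges {α : Type*} [DecidableEq α] :
    TopTree α → Finset (TopTree α × Bool × TopTree α)
  | edge _ _ => ∅
  | merge m l r => {(merge m l r, false, l), (merge m l r, true, r)}

/-- The vertices of the minimal DAG of a binary tree: identical rooted subtrees are shared, so there
is one vertex for each distinct rooted subtree. -/
def dagVertices {α : Type*} [DecidableEq α] (t : TopTree α) : Finset (TopTree α) :=
  t.subtrees

/-- The edges of the minimal DAG of a binary tree. -/
def dagEdges {α : Type*} [DecidableEq α] (t : TopTree α) :
    Finset (TopTree α × Bool × TopTree α) :=
  t.dagVertices.biUnion outEdges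

/-- The total size (vertices plus edges) of the minimal DAG. -/
def dagSize {α : Type*} [DecidableEq α] (t : TopTree α) : ℕ :=
  t.dagVertices.card + t.dagEdges.card

end TopTree

namespace TopTreeConstruction

open OTree

/-- The auxiliary rooted ordered tree of the construction. Its edges are the current clusters. It is
given by the ordered list of the subtrees hanging from the (unlabeled) root; the label of every
non-root node `v` is the cluster that the edge from `v` to its parent stands for, i.e. the root of
the part of the top tree built for that cluster. -/
abbrev AuxTree (α : Type*) := List (OTree (TopTree α))

/-- The auxiliary tree during an iteration: the mark `true` says that the edge to the parent was
created by a merge in the current iteration. -/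
abbrev MarkedTree (α : Type*) := OTree (TopTree α × Bool)

mutual
/-- Label the node at the root of a subtree of the input, whose parent is labeled `p`, by the edge
to its parent, and proceed downwards. -/
def initTree {α : Type*} (p : α) : OTree α → OTree (TopTree α)
  | node a ts => node (TopTree.edge p a) (initForest a ts)
/-- The same for all subtrees hanging from a node labeled `p`. -/
def initForest {α : Type*} (p : α) : List (OTree α) → List (OTree (TopTree α))
  | [] => []
  | t :: ts => initTree p t :: initForest p ts
end

/-- The initial auxiliary tree is the input tree itself, every edge being a cluster. -/
def init {α : Type*} : OTree α → AuxTree α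
  | node a ts => initForest a ts

/-- Merge the edges from a node to two consecutive children, at least one of which is a leaf. The
bottom boundary node, if any, is the child that is not a leaf, and it survives. -/
def mergeSiblings {α : Type*} : MarkedTree α → MarkedTree α → MarkedTree α
  | node (c, _) [], node (d, _) [] =>
      node (TopTree.merge MergeType.horizontalNone c d, true) []
  | node (c, _) [], node (d, _) us =>
      node (TopTree.merge MergeType.horizontalRight c d, true) us
  | node (c, _) ts, node (d, _) _ =>
      node (TopTree.merge MergeType.horizontalLeft c d, true) ts

/-- The horizontal merges among the children `v₁, …, vₖ` of one node: for `i = 1, …, ⌊k/2⌋` the edges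
to `v₂ᵢ₋₁` and `v₂ᵢ` are merged if one of these two nodes is a leaf. If `k ≥ 3` is odd, `vₖ` is a
leaf and `vₖ₋₂`, `vₖ₋₁` are not, then the edges to `vₖ₋₁` and `vₖ` are merged too. -/
def mergeChildren {α : Type*} : List (MarkedTree α) → List (MarkedTree α)
  | [] => []
  | [x] => [x]
  | [x, y, z] =>
      if x.isLeaf || y.isLeaf then [mergeSiblings x y, z]
      else if z.isLeaf then [x, mergeSiblings y z]
      else [x, y, z]
  | x :: y :: ts =>
      if x.isLeaf || y.isLeaf then mergeSiblings x y :: mergeChildren ts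
      else x :: y :: mergeChildren ts

mutual
/-- Step 1 at all nodes of a subtree. The horizontal merges below a node do not change whether it is
a leaf, so the order in which the nodes are treated is irrelevant. -/
def horizontalTree {α : Type*} : OTree (TopTree α) → MarkedTree α
  | node c ts => node (c, false) (mergeChildren (horizontalForest ts))
/-- Step 1 at all nodes of a list of subtrees (not yet at their common parent). -/
def horizontalForest {α : Type*} : List (OTree (TopTree α)) → List (MarkedTree α)
  | [] => []
  | t :: ts => horizontalTree t :: horizontalForest ts
end

/-- Step 1 at all nodes of the auxiliary tree. -/
def horizontalStep {α : Type*} (F : AuxTree α) : List (MarkedTree α) :=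
  mergeChildren (horizontalForest F)

/-- Consider a node `v` with cluster `c` to its parent and mark `m`. If `v` has exactly one child,
and neither of the two edges at `v` was merged before in this iteration, merge them. -/
def mergeParentChild {α : Type*} (c : TopTree α) (m : Bool) :
    List (MarkedTree α) → MarkedTree α
  | [node (d, false) us] =>
      if m then node (c, m) [node (d, false) us]
      else if us.isEmpty then node (TopTree.merge MergeType.verticalNoBottom c d, true) us
      else node (TopTree.merge MergeType.verticalBottom c d, true) us
  | ts => node (c, m) ts

mutual
/-- Step 2. Let `v₁, …, vₚ` be a maximal path such that `vᵢ₊₁` is the parent of `vᵢ` and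
`v₂, …, vₚ₋₁` had a single child at the beginning of the iteration; then at most the topmost edge of
the path was merged in Step 1. Working upwards and merging the two edges at `vᵢ` whenever both are
still unmerged pairs up the edges of the path from below: the first with the second, the third with
the fourth, and so on, where a last pair that contains the topmost edge is merged only if that edge
was not merged in Step 1. -/
def verticalTree {α : Type*} : MarkedTree α → MarkedTree α
  | node (c, m) ts => mergeParentChild c m (verticalForest ts)
/-- Step 2 on a list of subtrees hanging from the same node. -/
def verticalForest {α : Type*} : List (MarkedTree α) → List (MarkedTree α)
  | [] => []
  | t :: ts => verticalTree t :: verticalForest ts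
end

/-- One iteration: horizontal merges, then vertical merges; then the marks are erased. -/
def iteration {α : Type*} (F : AuxTree α) : AuxTree α :=
  mapLabelsForest Prod.fst (verticalForest (horizontalStep F))

end TopTreeConstruction

/-- `τ` is the top tree of `T`: the greedy construction, started with `T`, arrives at an auxiliary
tree that consists of a single edge, and `τ` is the cluster of this edge. -/
def IsTopTree {α : Type*} (T : OTree α) (τ : TopTree α) : Prop :=
  ∃ k : ℕ, TopTreeConstruction.iteration^[k] (TopTreeConstruction.init T) = [OTree.node τ []]

/-- The construction is deterministic and does nothing to a single edge, so there is at most one top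
tree. -/
theorem IsTopTree.unique {α : Type*} {T : OTree α} {τ τ' : TopTree α}
    (h : IsTopTree T τ) (h' : IsTopTree T τ') : τ = τ' := by
  have fix : ∀ (c : TopTree α) (n : ℕ),
      TopTreeConstruction.iteration^[n] [OTree.node c []] = [OTree.node c []] := by
    intro c n
    exact Function.iterate_fixed rfl n
  obtain ⟨k, hk⟩ := h
  obtain ⟨l, hl⟩ := h'
  have e1 := Function.iterate_add_apply TopTreeConstruction.iteration l k
    (TopTreeConstruction.init T)
  have e2 := Function.iterate_add_apply TopTreeConstruction.iteration k l
    (TopTreeConstruction.init T)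
  rw [hk, fix] at e1
  rw [hl, fix, Nat.add_comm, e1] at e2
  simpa using e2

/-!
Three facts about the greedy construction give the bound. Write `m i` for the number of edges of the
auxiliary tree after `i` iterations, `n` for the number of nodes of the input tree, and `σ` for the
size of the alphabet.

* A cluster takes part in at most one merge per iteration, so after `i` iterations every cluster is
  a binary tree of depth at most `i` (`forall_mem_labelsForest_iterate_init`). There are at most
  `σ ^ (5 * 2 ^ i)` of those (`card_depthLE_le`).
* As long as there are two edges, an iteration removes more than one eighth of them
  (`numNodesForest_iteration_le`), so that `m i ≤ (7 / 8) ^ i * n + 1`. Nodes with fewer than two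
  children make up more than half of the tree. Give every leaf a demand of `1 / 4` of a merge and
  every node with one child a demand of `1 / 8`; the total demand exceeds `1 / 8` of the number of
  edges. Pairing up the edges of a path, and the children of a branching node, always meets the
  demand: the worst cases are a leaf without a partner next to a merged pair of siblings, and a path
  with two edges whose upper edge was merged horizontally. `SizeBounds` is the corresponding
  invariant of an induction over the tree.
* Every merge removes one edge and creates at most one new vertex of the minimal DAG. Hence the
  merges after iteration `i` contribute at most `m i` vertices
  (`card_subtrees_le_card_depthLE_add`). The proof counts the nodes of the clusters outside the set
  of trees of depth at most `i`: this count plus the number of edges never increases, because each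
  merge raises the count by at most one (`sum_labelsForest_iteration_le`).

Thus the DAG has size `O(σ ^ (5 * 2 ^ i) + (7 / 8) ^ i * n)` for every `i` (`dagSize_le_pow_add`).
With `2 ^ i` of order `log_σ n / 10`, the first summand is at most `√n` and the second is
`O(n / (log_σ n) ^ c)` with `c = log₂ (8 / 7) > 0.19`. If `log_σ n < 10`, then the linear bound
`dagSize_le_mul_numNodes` suffices.
-/

/-! ### Labels and sizes of forests -/

namespace OTree

mutual
/-- The labels of a tree, in preorder. -/
def labels {β : Type*} : OTree β → List β
  | node a ts => a :: labelsForest ts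
/-- The labels of an ordered forest, in preorder. -/
def labelsForest {β : Type*} : List (OTree β) → List β
  | [] => []
  | t :: ts => labels t ++ labelsForest ts
end

mutual
theorem length_labels {β : Type*} : ∀ t : OTree β, t.labels.length = t.numNodes
  | node a ts => by
    rw [labels, numNodes, List.length_cons, length_labelsForest ts, add_comm]
theorem length_labelsForest {β : Type*} :
    ∀ ts : List (OTree β), (labelsForest ts).length = numNodesForest ts
  | [] => rfl
  | t :: ts => by
    rw [labelsForest, numNodesForest, List.length_append, length_labels t,
      length_labelsForest ts]
end

mutual
theorem labels_mapLabels {β γ : Type*} (f : β → γ) :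
    ∀ t : OTree β, (mapLabels f t).labels = t.labels.map f
  | node a ts => by
    rw [mapLabels, labels, labels, List.map_cons, labelsForest_mapLabelsForest f ts]
theorem labelsForest_mapLabelsForest {β γ : Type*} (f : β → γ) :
    ∀ ts : List (OTree β), labelsForest (mapLabelsForest f ts) = (labelsForest ts).map f
  | [] => rfl
  | t :: ts => by
    rw [mapLabelsForest, labelsForest, labelsForest, List.map_append, labels_mapLabels f t,
      labelsForest_mapLabelsForest f ts]
end

theorem numNodesForest_mapLabelsForest {β γ : Type*} (f : β → γ) (ts : List (OTree β)) :
    numNodesForest (mapLabelsForest f ts) = numNodesForest ts := by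
  rw [← length_labelsForest, ← length_labelsForest, labelsForest_mapLabelsForest,
    List.length_map]

theorem one_le_numNodes {β : Type*} : ∀ t : OTree β, 1 ≤ t.numNodes
  | node _ _ => by rw [numNodes]; omega

theorem numNodesForest_eq_zero {β : Type*} {ts : List (OTree β)} :
    numNodesForest ts = 0 ↔ ts = [] := by
  cases ts with
  | nil => simp [numNodesForest]
  | cons t ts =>
    have := one_le_numNodes t
    simp only [numNodesForest, reduceCtorEq, iff_false]
    omega

theorem numNodesForest_eq_one {β : Type*} {ts : List (OTree β)} (h : numNodesForest ts = 1) :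
    ∃ a, ts = [node a []] := by
  match ts, h with
  | node a us :: ts, h =>
    rw [numNodesForest, numNodes] at h
    have h1 := numNodesForest_eq_zero.1 (show numNodesForest us = 0 by omega)
    have h2 := numNodesForest_eq_zero.1 (show numNodesForest ts = 0 by omega)
    exact ⟨a, by rw [h1, h2]⟩

end OTree

namespace TopTreeConstruction

open OTree

variable {α : Type*}

/-! ### Subadditive weights of clusters -/

/-- The total weight of the clusters of a marked forest. -/
def weightForest (f : TopTree α → ℕ) (us : List (MarkedTree α)) : ℕ :=
  ((labelsForest us).map fun p => f p.1).sum

theorem weightForest_nil (f : TopTree α → ℕ) : weightForest f [] = 0 := rfl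

theorem weightForest_node_cons (f : TopTree α → ℕ) (c : TopTree α) (m : Bool)
    (ts us : List (MarkedTree α)) :
    weightForest f (node (c, m) ts :: us) = f c + weightForest f ts + weightForest f us := by
  simp [weightForest, labelsForest, labels, add_assoc]

theorem weightForest_cons (f : TopTree α → ℕ) (u : MarkedTree α) (us : List (MarkedTree α)) :
    weightForest f (u :: us) = weightForest f [u] + weightForest f us := by
  obtain ⟨⟨c, m⟩, ts⟩ := u
  simp [weightForest_node_cons, weightForest_nil]

theorem weightForest_mergeSiblings_le {f : TopTree α → ℕ}
    (hf : ∀ m c d, f (.merge m c d) ≤ f c + f d) (x y : MarkedTree α) :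
    weightForest f [mergeSiblings x y] ≤ weightForest f [x] + weightForest f [y] := by
  obtain ⟨⟨c, m⟩, ts⟩ := x
  obtain ⟨⟨d, n⟩, us⟩ := y
  have h := fun m => hf m c d
  cases ts <;> cases us <;>
    simp only [mergeSiblings, weightForest_node_cons, weightForest_nil] <;> grind

theorem weightForest_mergeChildren_le {f : TopTree α → ℕ}
    (hf : ∀ m c d, f (.merge m c d) ≤ f c + f d) (us : List (MarkedTree α)) :
    weightForest f (mergeChildren us) ≤ weightForest f us := by
  fun_induction mergeChildren us with
  | case1 => rfl
  | case2 => rfl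
  | case3 x y z =>
    have := weightForest_mergeSiblings_le hf x y
    rw [weightForest_cons, weightForest_cons f x, weightForest_cons f y]
    omega
  | case4 x y z =>
    have := weightForest_mergeSiblings_le hf y z
    rw [weightForest_cons f x [y, z], weightForest_cons f y,
      weightForest_cons f x [mergeSiblings y z]]
    omega
  | case5 => rfl
  | case6 x y ts _ _ ih =>
    have := weightForest_mergeSiblings_le hf x y
    rw [weightForest_cons, weightForest_cons f x, weightForest_cons f y]
    omega
  | case7 x y ts _ _ ih =>
    rw [weightForest_cons f x, weightForest_cons f y (mergeChildren ts),
      weightForest_cons f x (y :: ts), weightForest_cons f y ts]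
    omega

mutual
theorem weightForest_horizontalTree_le {f : TopTree α → ℕ}
    (hf : ∀ m c d, f (.merge m c d) ≤ f c + f d) :
    ∀ t : OTree (TopTree α), weightForest f [horizontalTree t] ≤ (t.labels.map f).sum
  | node c ts => by
    have h1 := weightForest_mergeChildren_le hf (horizontalForest ts)
    have h2 := weightForest_horizontalForest_le hf ts
    rw [horizontalTree, weightForest_node_cons, weightForest_nil, labels, List.map_cons,
      List.sum_cons]
    omega
theorem weightForest_horizontalForest_le {f : TopTree α → ℕ}
    (hf : ∀ m c d, f (.merge m c d) ≤ f c + f d) :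
    ∀ ts : List (OTree (TopTree α)),
      weightForest f (horizontalForest ts) ≤ ((labelsForest ts).map f).sum
  | [] => le_rfl
  | t :: ts => by
    have h1 := weightForest_horizontalTree_le hf t
    have h2 := weightForest_horizontalForest_le hf ts
    rw [horizontalForest, weightForest_cons, labelsForest, List.map_append, List.sum_append]
    omega
end

theorem weightForest_mergeParentChild_le {f : TopTree α → ℕ}
    (hf : ∀ m c d, f (.merge m c d) ≤ f c + f d) (c : TopTree α) (m : Bool)
    (us : List (MarkedTree α)) :
    weightForest f [mergeParentChild c m us] ≤ f c + weightForest f us := by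
  have h := fun m d => hf m c d
  fun_cases mergeParentChild c m us <;>
    simp only [weightForest_node_cons, weightForest_nil] <;> grind

mutual
theorem weightForest_verticalTree_le {f : TopTree α → ℕ}
    (hf : ∀ m c d, f (.merge m c d) ≤ f c + f d) :
    ∀ u : MarkedTree α, weightForest f [verticalTree u] ≤ weightForest f [u]
  | node (c, m) us => by
    have h1 := weightForest_mergeParentChild_le hf c m (verticalForest us)
    have h2 := weightForest_verticalForest_le hf us
    rw [verticalTree, weightForest_node_cons, weightForest_nil]
    omega
theorem weightForest_verticalForest_le {f : TopTree α → ℕ}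
    (hf : ∀ m c d, f (.merge m c d) ≤ f c + f d) :
    ∀ us : List (MarkedTree α), weightForest f (verticalForest us) ≤ weightForest f us
  | [] => le_rfl
  | u :: us => by
    have h1 := weightForest_verticalTree_le hf u
    have h2 := weightForest_verticalForest_le hf us
    rw [verticalForest, weightForest_cons, weightForest_cons f u]
    omega
end

/-- An iteration does not increase the total weight of the clusters, if the weight of a merged
cluster is at most the sum of the weights of its two parts. -/
theorem sum_labelsForest_iteration_le {f : TopTree α → ℕ}
    (hf : ∀ m c d, f (.merge m c d) ≤ f c + f d) (F : AuxTree α) :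
    ((labelsForest (iteration F)).map f).sum ≤ ((labelsForest F).map f).sum := by
  rw [iteration, labelsForest_mapLabelsForest, List.map_map]
  exact ((weightForest_verticalForest_le hf _).trans (weightForest_mergeChildren_le hf _)).trans
    (weightForest_horizontalForest_le hf F)

/-! ### Properties of the clusters after an iteration -/

/-- Every unmarked cluster of a marked forest satisfies `P`, and every marked one satisfies `Q`. -/
def AllClusters (P Q : TopTree α → Prop) (us : List (MarkedTree α)) : Prop :=
  ∀ p ∈ labelsForest us, if p.2 then Q p.1 else P p.1

theorem allClusters_nil (P Q : TopTree α → Prop) : AllClusters P Q [] := by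
  simp [AllClusters, labelsForest]

theorem allClusters_node_cons {P Q : TopTree α → Prop} {c : TopTree α} {m : Bool}
    {ts us : List (MarkedTree α)} :
    AllClusters P Q (node (c, m) ts :: us) ↔
      (if m then Q c else P c) ∧ AllClusters P Q ts ∧ AllClusters P Q us := by
  simp only [AllClusters, labelsForest, labels, List.cons_append, List.mem_cons, List.mem_append,
    or_imp, forall_and, forall_eq]

theorem allClusters_cons {P Q : TopTree α → Prop} {u : MarkedTree α} {us : List (MarkedTree α)} :
    AllClusters P Q (u :: us) ↔ AllClusters P Q [u] ∧ AllClusters P Q us := by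
  simp only [AllClusters, labelsForest, List.mem_append]
  grind

/-- The edge from the root of the tree to its parent is unmarked. -/
def Unmarked : MarkedTree α → Prop
  | node (_, m) _ => m = false

theorem allClusters_mergeSiblings {P Q : TopTree α → Prop}
    (hQ : ∀ m c d, P c → P d → Q (.merge m c d)) {x y : MarkedTree α} (hx : Unmarked x)
    (hy : Unmarked y) (hPx : AllClusters P Q [x]) (hPy : AllClusters P Q [y]) :
    AllClusters P Q [mergeSiblings x y] := by
  obtain ⟨⟨c, m⟩, ts⟩ := x
  obtain ⟨⟨d, n⟩, us⟩ := y
  have h := fun m => hQ m c d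
  cases hx
  cases hy
  cases ts <;> cases us <;> simp only [mergeSiblings, allClusters_node_cons] at * <;> grind

theorem allClusters_mergeChildren {P Q : TopTree α → Prop}
    (hQ : ∀ m c d, P c → P d → Q (.merge m c d)) {us : List (MarkedTree α)}
    (hus : ∀ u ∈ us, Unmarked u) (hP : AllClusters P Q us) :
    AllClusters P Q (mergeChildren us) := by
  fun_induction mergeChildren us with
  | case1 => exact hP
  | case2 => exact hP
  | case3 x y z =>
    have := @allClusters_mergeSiblings _ _ _ hQ x y
    rw [allClusters_cons, allClusters_cons (u := y)] at hP
    rw [allClusters_cons]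
    grind
  | case4 x y z =>
    have := @allClusters_mergeSiblings _ _ _ hQ y z
    rw [allClusters_cons, allClusters_cons (u := y)] at hP
    rw [allClusters_cons]
    grind
  | case5 => exact hP
  | case6 x y ts _ _ ih =>
    have := @allClusters_mergeSiblings _ _ _ hQ x y
    rw [allClusters_cons, allClusters_cons (u := y)] at hP
    rw [allClusters_cons]
    grind
  | case7 x y ts _ _ ih =>
    rw [allClusters_cons, allClusters_cons (u := y)] at hP ⊢
    grind

theorem unmarked_of_mem_horizontalForest :
    ∀ {ts : List (OTree (TopTree α))}, ∀ u ∈ horizontalForest ts, Unmarked u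
  | [], _, h => by simp [horizontalForest] at h
  | node c us :: ts, u, h => by
    rw [horizontalForest, List.mem_cons] at h
    obtain rfl | h := h
    · rfl
    · exact unmarked_of_mem_horizontalForest u h

mutual
theorem allClusters_horizontalTree {P Q : TopTree α → Prop}
    (hQ : ∀ m c d, P c → P d → Q (.merge m c d)) :
    ∀ t : OTree (TopTree α), (∀ c ∈ t.labels, P c) → AllClusters P Q [horizontalTree t]
  | node c ts, h => by
    simp only [labels, List.mem_cons, forall_eq_or_imp] at h
    rw [horizontalTree, allClusters_node_cons]
    exact ⟨h.1, allClusters_mergeChildren hQ unmarked_of_mem_horizontalForest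
      (allClusters_horizontalForest hQ ts h.2), allClusters_nil P Q⟩
theorem allClusters_horizontalForest {P Q : TopTree α → Prop}
    (hQ : ∀ m c d, P c → P d → Q (.merge m c d)) :
    ∀ ts : List (OTree (TopTree α)), (∀ c ∈ labelsForest ts, P c) →
      AllClusters P Q (horizontalForest ts)
  | [], _ => allClusters_nil P Q
  | t :: ts, h => by
    simp only [labelsForest, List.mem_append] at h
    rw [horizontalForest, allClusters_cons]
    exact ⟨allClusters_horizontalTree hQ t fun c hc => h c (.inl hc),
      allClusters_horizontalForest hQ ts fun c hc => h c (.inr hc)⟩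
end

theorem allClusters_mergeParentChild {P Q : TopTree α → Prop}
    (hQ : ∀ m c d, P c → P d → Q (.merge m c d)) {c : TopTree α} {m : Bool}
    {us : List (MarkedTree α)} (hc : if m then Q c else P c) (hus : AllClusters P Q us) :
    AllClusters P Q [mergeParentChild c m us] := by
  have h := fun m d => hQ m c d
  have h0 := allClusters_nil P Q
  fun_cases mergeParentChild c m us <;> simp only [allClusters_node_cons] at * <;> grind

mutual
theorem allClusters_verticalTree {P Q : TopTree α → Prop}
    (hQ : ∀ m c d, P c → P d → Q (.merge m c d)) :
    ∀ u : MarkedTree α, AllClusters P Q [u] → AllClusters P Q [verticalTree u]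
  | node (c, m) us, h => by
    rw [allClusters_node_cons] at h
    exact allClusters_mergeParentChild hQ h.1 (allClusters_verticalForest hQ us h.2.1)
theorem allClusters_verticalForest {P Q : TopTree α → Prop}
    (hQ : ∀ m c d, P c → P d → Q (.merge m c d)) :
    ∀ us : List (MarkedTree α), AllClusters P Q us → AllClusters P Q (verticalForest us)
  | [], h => h
  | u :: us, h => by
    rw [allClusters_cons] at h
    rw [verticalForest, allClusters_cons]
    exact ⟨allClusters_verticalTree hQ u h.1, allClusters_verticalForest hQ us h.2⟩
end

/-- A cluster takes part in at most one merge per iteration, because merged edges are marked. Hence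
a property `Q` of the new clusters only has to be checked for a single merge of old ones. -/
theorem forall_mem_labelsForest_iteration {P Q : TopTree α → Prop} (hPQ : ∀ c, P c → Q c)
    (hQ : ∀ m c d, P c → P d → Q (.merge m c d)) {F : AuxTree α}
    (hF : ∀ c ∈ labelsForest F, P c) : ∀ c ∈ labelsForest (iteration F), Q c := by
  have h : AllClusters P Q (verticalForest (horizontalStep F)) :=
    allClusters_verticalForest hQ _ (allClusters_mergeChildren hQ unmarked_of_mem_horizontalForest
      (allClusters_horizontalForest hQ F hF))
  rw [iteration, labelsForest_mapLabelsForest]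
  simp only [List.mem_map, Prod.exists, exists_and_right, exists_eq_right]
  rintro c ⟨_ | _, hc⟩
  · exact hPQ c (h _ hc)
  · exact h _ hc

/-! ### The number of edges after an iteration -/

/-- The number of edges into which the vertical merges turn the given tree together with the edge to
its parent, if the latter edge was already merged in the horizontal step. -/
def markedSize : MarkedTree α → ℕ
  | node _ us => 1 + numNodesForest (verticalForest us)

theorem numNodes_verticalTree_of_marked (c : TopTree α) (us : List (MarkedTree α)) :
    (verticalTree (node (c, true) us)).numNodes = markedSize (node (c, true) us) := by
  rw [verticalTree, markedSize]
  fun_cases mergeParentChild c true (verticalForest us) <;> simp_all [numNodes]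

theorem numNodes_verticalTree_mergeSiblings {x y : MarkedTree α} (h : x.isLeaf || y.isLeaf) :
    (verticalTree (mergeSiblings x y)).numNodes + 1 = markedSize x + markedSize y := by
  obtain ⟨⟨c, m⟩, ts⟩ := x
  obtain ⟨⟨d, n⟩, us⟩ := y
  cases ts <;> cases us <;>
    simp_all [mergeSiblings, numNodes_verticalTree_of_marked, markedSize, verticalForest,
      numNodesForest, isLeaf]
  omega

/-- A merge of an edge with the edge below it saves one edge; if there is none, then the edge stays
available, provided that it was so before. -/
theorem numNodes_mergeParentChild (c : TopTree α) (vs : List (MarkedTree α)) :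
    (mergeParentChild c false vs).numNodes = numNodesForest vs ∨
      (mergeParentChild c false vs).numNodes = 1 + numNodesForest vs ∧
        Unmarked (mergeParentChild c false vs) ∧ ∀ v, vs = [v] → ¬ Unmarked v := by
  fun_cases mergeParentChild c false vs with
  | case1 => simp_all
  | case2 => simp [numNodes, numNodesForest]
  | case3 => simp [numNodes, numNodesForest]
  | case4 =>
    refine .inr ⟨by rw [numNodes], rfl, ?_⟩
    rintro ⟨⟨d, n⟩, us⟩ rfl hv
    cases hv
    simp_all

/-- Bounds for the number of edges an iteration leaves of a tree `t` and its edge to the parent.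
Call `8 * s' + 1 - 7 * s` the deficit, where `s` and `s'` are the numbers of edges before and after.
The deficit is at most `2` for a leaf and at most `0` otherwise; if the topmost edge is merged
vertically, hence not available for a merge with the edge above it, the deficit is at most `-5`; if
the topmost edge was merged horizontally, hence not available for vertical merges, the deficit is at
most `2` for a leaf and at most `3` otherwise. -/
structure SizeBounds (t : OTree (TopTree α)) : Prop where
  le : 8 * (verticalTree (horizontalTree t)).numNodes + 1 ≤
    7 * t.numNodes + if (horizontalTree t).isLeaf then 2 else 0
  le_of_not_unmarked : ¬ Unmarked (verticalTree (horizontalTree t)) →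
    8 * (verticalTree (horizontalTree t)).numNodes + 6 ≤ 7 * t.numNodes
  markedSize_le : 8 * markedSize (horizontalTree t) + 1 ≤
    7 * t.numNodes + if (horizontalTree t).isLeaf then 2 else 3

theorem numNodesForest_verticalForest_mergeChildren_triple_le {x y z : OTree (TopTree α)}
    (hx : SizeBounds x) (hy : SizeBounds y) (hz : SizeBounds z) :
    8 * numNodesForest (verticalForest (mergeChildren (horizontalForest [x, y, z]))) + 3 ≤
      7 * numNodesForest [x, y, z] := by
  obtain ⟨hx, -, hx'⟩ := hx
  obtain ⟨hy, -, hy'⟩ := hy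
  obtain ⟨hz, -, hz'⟩ := hz
  have hxy := @numNodes_verticalTree_mergeSiblings _ (horizontalTree x) (horizontalTree y)
  have hyz := @numNodes_verticalTree_mergeSiblings _ (horizontalTree y) (horizontalTree z)
  simp only [horizontalForest, mergeChildren]
  simp only [numNodesForest]
  split_ifs <;> simp only [verticalForest, numNodesForest] <;> grind

/-- At least two siblings have total deficit at most `0`, because a horizontal merge reduces the
deficit by `8`. -/
theorem numNodesForest_verticalForest_mergeChildren_le : ∀ ts : List (OTree (TopTree α)),
    (∀ t ∈ ts, SizeBounds t) → ts.length ≠ 1 →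
    8 * numNodesForest (verticalForest (mergeChildren (horizontalForest ts))) + ts.length ≤
      7 * numNodesForest ts
  | [], _, _ => by simp [horizontalForest, mergeChildren, verticalForest, numNodesForest]
  | x :: y :: ts, h, _ => by
    by_cases hts : ts.length = 1
    · obtain ⟨z, rfl⟩ := List.length_eq_one_iff.1 hts
      exact numNodesForest_verticalForest_mergeChildren_triple_le (h x (by simp)) (h y (by simp))
        (h z (by simp))
    have ih := numNodesForest_verticalForest_mergeChildren_le ts (by grind) hts
    obtain ⟨hx, -, hx'⟩ := h x (by simp)
    obtain ⟨hy, -, hy'⟩ := h y (by simp)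
    have hxy := @numNodes_verticalTree_mergeSiblings _ (horizontalTree x) (horizontalTree y)
    have hm : mergeChildren (horizontalForest (x :: y :: ts)) =
        if (horizontalTree x).isLeaf || (horizontalTree y).isLeaf then
          mergeSiblings (horizontalTree x) (horizontalTree y) :: mergeChildren (horizontalForest ts)
        else horizontalTree x :: horizontalTree y :: mergeChildren (horizontalForest ts) := by
      rw [horizontalForest, horizontalForest, mergeChildren]
      rintro z hz
      match ts, hts, hz with
      | [t], hts, _ => simp at hts
    rw [hm]
    simp only [numNodesForest, List.length_cons]
    split_ifs <;> simp only [verticalForest, numNodesForest] <;> grind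

theorem mergeChildren_ne_nil : ∀ {us : List (MarkedTree α)}, us ≠ [] → mergeChildren us ≠ []
  | [], h => absurd rfl h
  | [x], _ => by simp [mergeChildren]
  | [x, y], _ => by rw [mergeChildren]; split <;> simp; simp
  | [x, y, z], _ => by rw [mergeChildren]; split_ifs <;> simp
  | x :: y :: z :: w :: us, _ => by rw [mergeChildren]; split <;> simp; simp

theorem isLeaf_horizontalTree (c : TopTree α) (ts : List (OTree (TopTree α))) :
    (horizontalTree (node c ts)).isLeaf = ts.isEmpty := by
  rw [horizontalTree, isLeaf]
  cases ts with
  | nil => rfl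
  | cons t ts =>
    have := mergeChildren_ne_nil (us := horizontalForest (t :: ts)) (by simp [horizontalForest])
    simp [this]

mutual
theorem sizeBounds : ∀ t : OTree (TopTree α), SizeBounds t
  | node c [] => by
    constructor <;> simp [horizontalTree, horizontalForest, mergeChildren, verticalTree,
      verticalForest, mergeParentChild, numNodes, numNodesForest, markedSize, isLeaf, Unmarked]
  | node c [t] => by
    obtain ⟨h1, h2, h3⟩ := sizeBounds t
    have hl := isLeaf_horizontalTree c [t]
    have hH : horizontalTree (node c [t]) = node (c, false) [horizontalTree t] := rfl
    have hp := numNodes_mergeParentChild c [verticalTree (horizontalTree t)]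
    have hs : (node c [t]).numNodes = 1 + t.numNodes := rfl
    rw [hH] at hl
    constructor <;> rw [hH] <;>
      simp only [hl, hs, verticalTree, verticalForest, markedSize, numNodesForest] at * <;>
      grind
  | node c (t :: t' :: ts) => by
    have h := numNodesForest_verticalForest_mergeChildren_le (t :: t' :: ts)
      (sizeBounds_of_mem (t :: t' :: ts)) (by simp)
    have hl := isLeaf_horizontalTree c (t :: t' :: ts)
    have hp := numNodes_mergeParentChild c
      (verticalForest (mergeChildren (horizontalForest (t :: t' :: ts))))
    have hs := numNodes.eq_1 c (t :: t' :: ts)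
    rw [List.length_cons, List.length_cons] at h
    have hH := horizontalTree.eq_1 c (t :: t' :: ts)
    rw [hH] at hl
    constructor <;> rw [hH] <;> simp only [hl, hs, verticalTree, markedSize] <;> grind
theorem sizeBounds_of_mem : ∀ ts : List (OTree (TopTree α)), ∀ t ∈ ts, SizeBounds t
  | [], _, h => by simp at h
  | t :: ts, u, h => by
    rw [List.mem_cons] at h
    obtain h | h := h
    · rw [h]
      exact sizeBounds t
    · exact sizeBounds_of_mem ts u h
end

/-- An iteration reduces the number of edges by more than one eighth. -/
theorem numNodesForest_iteration_le {F : AuxTree α} (hF : 2 ≤ numNodesForest F) :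
    8 * numNodesForest (iteration F) + 1 ≤ 7 * numNodesForest F := by
  rw [iteration, numNodesForest_mapLabelsForest, horizontalStep]
  match F, hF with
  | [node c ts], hF =>
    have h := (sizeBounds (node c ts)).le
    rw [isLeaf_horizontalTree] at h
    cases ts with
    | nil => simp [numNodesForest, numNodes] at hF
    | cons t ts => simpa [horizontalForest, mergeChildren, verticalForest, numNodesForest] using h
  | [], hF => simp [numNodesForest] at hF
  | t :: t' :: ts, _ =>
    have h := numNodesForest_verticalForest_mergeChildren_le (t :: t' :: ts)
      (sizeBounds_of_mem (t :: t' :: ts)) (by simp)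
    rw [List.length_cons] at h
    omega

theorem iteration_ne_nil {F : AuxTree α} (hF : F ≠ []) : iteration F ≠ [] := by
  have h1 : horizontalStep F ≠ [] := by
    refine mergeChildren_ne_nil ?_
    cases F with
    | nil => exact absurd rfl hF
    | cons t ts => simp [horizontalForest]
  rw [iteration]
  cases h : horizontalStep F with
  | nil => exact absurd h h1
  | cons t ts => simp [verticalForest, mapLabelsForest]

end TopTreeConstruction

namespace TopTree

variable {α : Type*} [DecidableEq α]

/-! ### Counting distinct subtrees -/

/-- The number of occurrences in a binary tree of subtrees outside `K`, where nothing below an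
element of `K` is counted. -/
def countOutside (K : Finset (TopTree α)) : TopTree α → ℕ
  | edge a b => if edge a b ∈ K then 0 else 1
  | merge m l r => if merge m l r ∈ K then 0 else 1 + countOutside K l + countOutside K r

theorem countOutside_eq_zero {K : Finset (TopTree α)} {t : TopTree α} (ht : t ∈ K) :
    countOutside K t = 0 := by
  cases t <;> simp [countOutside, ht]

theorem countOutside_merge_le (K : Finset (TopTree α)) (m : MergeType) (l r : TopTree α) :
    countOutside K (merge m l r) ≤ 1 + countOutside K l + countOutside K r := by
  rw [countOutside]
  split_ifs <;> omega

theorem card_subtrees_sdiff_le {K : Finset (TopTree α)} (hK : ∀ t ∈ K, t.subtrees ⊆ K)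
    (t : TopTree α) : (t.subtrees \ K).card ≤ countOutside K t := by
  by_cases ht : t ∈ K
  · simp [Finset.sdiff_eq_empty_iff_subset.2 (hK t ht)]
  induction t with
  | edge a b =>
    exact (Finset.card_le_card Finset.sdiff_subset).trans (by simp [subtrees, countOutside, ht])
  | merge m l r ihl ihr =>
    have hl : (l.subtrees \ K).card ≤ countOutside K l := by
      by_cases hl : l ∈ K
      · simp [Finset.sdiff_eq_empty_iff_subset.2 (hK l hl)]
      · exact ihl hl
    have hr : (r.subtrees \ K).card ≤ countOutside K r := by
      by_cases hr : r ∈ K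
      · simp [Finset.sdiff_eq_empty_iff_subset.2 (hK r hr)]
      · exact ihr hr
    have h1 := Finset.card_insert_le (merge m l r) (l.subtrees \ K ∪ r.subtrees \ K)
    have h2 := Finset.card_union_le (l.subtrees \ K) (r.subtrees \ K)
    rw [subtrees, Finset.insert_sdiff_of_notMem _ ht, Finset.union_sdiff_distrib, countOutside,
      if_neg ht]
    omega

theorem card_subtrees_le {K : Finset (TopTree α)} (hK : ∀ t ∈ K, t.subtrees ⊆ K)
    (t : TopTree α) : t.subtrees.card ≤ K.card + countOutside K t := by
  have h1 := card_subtrees_sdiff_le hK t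
  have h2 := Finset.card_le_card_sdiff_add_card (s := t.subtrees) (t := K)
  omega

theorem dagSize_le (t : TopTree α) : t.dagSize ≤ 3 * t.subtrees.card := by
  have h : t.dagEdges.card ≤ t.subtrees.card * 2 := by
    refine Finset.card_biUnion_le_card_mul _ _ _ fun u _ => ?_
    cases u with
    | edge a b => simp [outEdges]
    | merge m l r => exact Finset.card_le_two
  rw [dagSize, dagVertices]
  omega

/-! ### Binary trees of bounded depth -/

/-- All merge types. -/
def mergeTypes : Finset MergeType :=
  {.verticalBottom, .verticalNoBottom, .horizontalLeft, .horizontalRight, .horizontalNone}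

theorem mem_mergeTypes (m : MergeType) : m ∈ mergeTypes := by
  cases m <;> simp [mergeTypes]

variable [Fintype α]

/-- All binary trees that consist of a single leaf. -/
def edges (α : Type*) [DecidableEq α] [Fintype α] : Finset (TopTree α) :=
  (Finset.univ : Finset (α × α)).image fun p => edge p.1 p.2

/-- All binary trees of depth at most `i`. -/
def depthLE (α : Type*) [DecidableEq α] [Fintype α] : ℕ → Finset (TopTree α)
  | 0 => edges α
  | i + 1 => edges α ∪
      (mergeTypes ×ˢ depthLE α i ×ˢ depthLE α i).image fun p => merge p.1 p.2.1 p.2.2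

theorem edge_mem_depthLE (a b : α) (i : ℕ) : edge a b ∈ depthLE α i := by
  cases i <;> simp [depthLE, edges]

theorem merge_mem_depthLE_succ {m : MergeType} {l r : TopTree α} {i : ℕ} :
    merge m l r ∈ depthLE α (i + 1) ↔ l ∈ depthLE α i ∧ r ∈ depthLE α i := by
  simp [depthLE, edges, mem_mergeTypes]

theorem depthLE_subset_succ (i : ℕ) : depthLE α i ⊆ depthLE α (i + 1) := by
  induction i with
  | zero => exact Finset.subset_union_left
  | succ i ih =>
    intro t ht
    cases t with
    | edge a b => exact edge_mem_depthLE a b _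
    | merge m l r =>
      rw [merge_mem_depthLE_succ] at ht ⊢
      exact ⟨ih ht.1, ih ht.2⟩

theorem subtrees_subset_depthLE {i : ℕ} : ∀ t ∈ depthLE α i, t.subtrees ⊆ depthLE α i := by
  induction i with
  | zero =>
    intro t ht
    cases t with
    | edge a b => simpa [subtrees] using ht
    | merge m l r => simp [depthLE, edges] at ht
  | succ i ih =>
    intro t ht
    cases t with
    | edge a b => simpa [subtrees] using ht
    | merge m l r =>
      have h := merge_mem_depthLE_succ.1 ht
      rw [subtrees, Finset.insert_subset_iff, Finset.union_subset_iff]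
      exact ⟨ht, (ih l h.1).trans (depthLE_subset_succ i), (ih r h.2).trans (depthLE_subset_succ i)⟩

theorem card_edges_le : (edges α).card ≤ Fintype.card α ^ 2 :=
  Finset.card_image_le.trans (by simp [sq])

theorem card_depthLE_succ_le (i : ℕ) :
    (depthLE α (i + 1)).card ≤ Fintype.card α ^ 2 + 5 * (depthLE α i).card ^ 2 := by
  refine (Finset.card_union_le _ _).trans (add_le_add card_edges_le (Finset.card_image_le.trans ?_))
  rw [Finset.card_product, Finset.card_product, ← sq]
  rfl

/-- The factor `Fintype.card α ^ 3` makes the induction on the depth go through. -/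
theorem card_depthLE_mul_le (hα : 2 ≤ Fintype.card α) (i : ℕ) :
    (depthLE α i).card * Fintype.card α ^ 3 ≤ Fintype.card α ^ (5 * 2 ^ i) := by
  induction i with
  | zero =>
    calc _ ≤ Fintype.card α ^ 2 * Fintype.card α ^ 3 := Nat.mul_le_mul_right _ card_edges_le
      _ = _ := by ring
  | succ i ih =>
    have h := card_depthLE_succ_le (α := α) i
    generalize (depthLE α i).card = k at *
    generalize Fintype.card α = s at *
    have hs : 8 ≤ s ^ 3 := by simpa using Nat.pow_le_pow_left hα 3
    have h5 : s ^ 5 ≤ s ^ (5 * 2 ^ i) :=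
      Nat.pow_le_pow_right (by omega) (Nat.le_mul_of_pos_right 5 (by positivity))
    have hq : s ^ (5 * 2 ^ (i + 1)) = (s ^ (5 * 2 ^ i)) ^ 2 := by ring
    rw [hq]
    generalize s ^ (5 * 2 ^ i) = q at *
    have h1 : 8 * (s ^ 3 * k ^ 2) ≤ q ^ 2 := calc
      8 * (s ^ 3 * k ^ 2) ≤ s ^ 3 * (s ^ 3 * k ^ 2) := Nat.mul_le_mul_right _ hs
      _ = (k * s ^ 3) ^ 2 := by ring
      _ ≤ q ^ 2 := Nat.pow_le_pow_left ih 2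
    have h2 : 8 * s ^ 5 ≤ q ^ 2 := calc
      8 * s ^ 5 ≤ s ^ 5 * s ^ 5 :=
        Nat.mul_le_mul_right _ (hs.trans (Nat.pow_le_pow_right (by omega) (by omega)))
      _ = (s ^ 5) ^ 2 := by ring
      _ ≤ q ^ 2 := Nat.pow_le_pow_left h5 2
    calc _ ≤ (s ^ 2 + 5 * k ^ 2) * s ^ 3 := Nat.mul_le_mul_right _ h
      _ = s ^ 5 + 5 * (s ^ 3 * k ^ 2) := by ring
      _ ≤ q ^ 2 := by omega

theorem card_depthLE_le (hα : 2 ≤ Fintype.card α) (i : ℕ) :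
    (depthLE α i).card ≤ Fintype.card α ^ (5 * 2 ^ i) :=
  (Nat.le_mul_of_pos_right _ (by positivity)).trans (card_depthLE_mul_le hα i)

end TopTree

namespace TopTreeConstruction

open OTree

/-! ### The top tree and its minimal DAG -/

variable {α : Type*}

mutual
theorem forall_mem_labels_initTree {P : TopTree α → Prop} (hP : ∀ a b, P (.edge a b)) :
    ∀ (p : α) (t : OTree α), ∀ c ∈ (initTree p t).labels, P c
  | p, node a ts => by
    simp only [initTree, labels, List.mem_cons, forall_eq_or_imp]
    exact ⟨hP p a, forall_mem_labelsForest_initForest hP a ts⟩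
theorem forall_mem_labelsForest_initForest {P : TopTree α → Prop} (hP : ∀ a b, P (.edge a b)) :
    ∀ (p : α) (ts : List (OTree α)), ∀ c ∈ labelsForest (initForest p ts), P c
  | _, [] => by simp [initForest, labelsForest]
  | p, t :: ts => by
    simp only [initForest, labelsForest, List.mem_append, or_imp, forall_and]
    exact ⟨forall_mem_labels_initTree hP p t, forall_mem_labelsForest_initForest hP p ts⟩
end

mutual
theorem numNodes_initTree : ∀ (p : α) (t : OTree α), (initTree p t).numNodes = t.numNodes
  | p, node a ts => by rw [initTree, numNodes, numNodes, numNodesForest_initForest]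
theorem numNodesForest_initForest : ∀ (p : α) (ts : List (OTree α)),
    numNodesForest (initForest p ts) = numNodesForest ts
  | _, [] => rfl
  | p, t :: ts => by
    rw [initForest, numNodesForest, numNodesForest, numNodes_initTree, numNodesForest_initForest]
end

theorem numNodesForest_init_add_one (T : OTree α) : numNodesForest (init T) + 1 = T.numNodes := by
  obtain ⟨a, ts⟩ := T
  rw [init, numNodesForest_initForest, numNodes, add_comm]

theorem forall_mem_labelsForest_init {P : TopTree α → Prop} (hP : ∀ a b, P (.edge a b))
    (T : OTree α) : ∀ c ∈ labelsForest (init T), P c := by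
  obtain ⟨a, ts⟩ := T
  exact forall_mem_labelsForest_initForest hP a ts

theorem sum_labelsForest_iterate_le {f : TopTree α → ℕ}
    (hf : ∀ m c d, f (.merge m c d) ≤ f c + f d) (F : AuxTree α) (k : ℕ) :
    ((labelsForest (iteration^[k] F)).map f).sum ≤ ((labelsForest F).map f).sum := by
  induction k with
  | zero => rfl
  | succ k ih =>
    rw [Function.iterate_succ_apply']
    exact (sum_labelsForest_iteration_le hf _).trans ih

/-- Once a single edge is left, the bound `(7 / 8) ^ i * m` of the number of edges may fail, hence
the summand `1`. -/
theorem numNodesForest_iterate_le (F : AuxTree α) (i : ℕ) :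
    (numNodesForest (iteration^[i] F) : ℝ) ≤ (7 / 8) ^ i * numNodesForest F + 1 := by
  induction i with
  | zero => simp
  | succ i ih =>
    rw [Function.iterate_succ_apply']
    generalize iteration^[i] F = G at *
    by_cases hG : 2 ≤ numNodesForest G
    · have h : (8 * numNodesForest (iteration G) + 1 : ℝ) ≤ 7 * numNodesForest G := by
        exact_mod_cast numNodesForest_iteration_le hG
      rw [pow_succ]
      linarith
    · have h : numNodesForest (iteration G) ≤ numNodesForest G := by
        have := sum_labelsForest_iteration_le (f := fun _ => 1) (by simp) G
        simpa [length_labelsForest] using this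
      have h1 : (numNodesForest (iteration G) : ℝ) ≤ 1 := by
        exact_mod_cast h.trans (by omega)
      have h2 : 0 ≤ (7 / 8 : ℝ) ^ (i + 1) * numNodesForest F := by positivity
      linarith

theorem exists_iterate_eq_singleton {F : AuxTree α} (hF : F ≠ []) :
    ∃ (k : ℕ) (τ : TopTree α), iteration^[k] F = [node τ []] := by
  induction h : numNodesForest F using Nat.strong_induction_on generalizing F with
  | _ n ih =>
    subst h
    by_cases h2 : 2 ≤ numNodesForest F
    · have h3 := numNodesForest_iteration_le h2
      obtain ⟨k, τ, hk⟩ := ih _ (by omega) (iteration_ne_nil hF) rfl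
      exact ⟨k + 1, τ, hk⟩
    · have h1 : numNodesForest F ≠ 0 := fun h => hF (numNodesForest_eq_zero.1 h)
      obtain ⟨τ, hτ⟩ := numNodesForest_eq_one (show numNodesForest F = 1 by omega)
      exact ⟨0, τ, hτ⟩

theorem exists_isTopTree {T : OTree α} (hT : 2 ≤ T.numNodes) : ∃ τ, IsTopTree T τ := by
  obtain ⟨k, τ, hτ⟩ := exists_iterate_eq_singleton (F := init T) fun h => by
    have := numNodesForest_init_add_one T
    rw [numNodesForest_eq_zero.2 h] at this
    omega
  exact ⟨τ, k, hτ⟩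

variable [DecidableEq α]

/-- The nodes of the top tree outside `K` are charged to the merges: a merge reduces the number of
edges of the auxiliary tree by one and creates at most one node outside `K`. -/
theorem countOutside_add_one_le (K : Finset (TopTree α)) {F : AuxTree α} {τ : TopTree α} {k : ℕ}
    (hk : iteration^[k] F = [node τ []]) :
    τ.countOutside K + 1 ≤ ((labelsForest F).map fun c => c.countOutside K + 1).sum := by
  have h := sum_labelsForest_iterate_le (f := fun c => c.countOutside K + 1)
    (fun m c d => by have := TopTree.countOutside_merge_le K m c d; omega) F k
  rw [hk] at h
  simpa [labelsForest, labels] using h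

theorem dagSize_le_mul_numNodes {T : OTree α} {τ : TopTree α} (hτ : IsTopTree T τ) :
    τ.dagSize ≤ 6 * T.numNodes := by
  obtain ⟨k, hk⟩ := hτ
  have h1 := countOutside_add_one_le ∅ hk
  have h2 := List.sum_le_card_nsmul ((labelsForest (init T)).map fun c => c.countOutside ∅ + 1) 2
    (by
      simp only [List.mem_map, forall_exists_index, and_imp, forall_apply_eq_imp_iff₂]
      exact forall_mem_labelsForest_init (by simp [TopTree.countOutside]) T)
  rw [List.length_map, length_labelsForest, smul_eq_mul] at h2
  have h3 := TopTree.card_subtrees_le (K := ∅) (by simp) τ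
  have h4 := τ.dagSize_le
  have h5 := numNodesForest_init_add_one T
  rw [Finset.card_empty] at h3
  omega

theorem forall_mem_labelsForest_iterate_init [Fintype α] (T : OTree α) (i : ℕ) :
    ∀ c ∈ labelsForest (iteration^[i] (init T)), c ∈ TopTree.depthLE α i := by
  induction i with
  | zero => exact forall_mem_labelsForest_init (fun a b => TopTree.edge_mem_depthLE a b 0) T
  | succ i ih =>
    rw [Function.iterate_succ_apply']
    exact forall_mem_labelsForest_iteration (P := (· ∈ TopTree.depthLE α i))
      (fun c hc => TopTree.depthLE_subset_succ i hc)
      (fun m c d hc hd => TopTree.merge_mem_depthLE_succ.2 ⟨hc, hd⟩) ih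

theorem card_subtrees_le_card_depthLE_add [Fintype α] {T : OTree α} {τ : TopTree α}
    (hτ : IsTopTree T τ) (i : ℕ) :
    τ.subtrees.card ≤
      (TopTree.depthLE α i).card + numNodesForest (iteration^[i] (init T)) := by
  obtain ⟨k, hk⟩ := hτ
  -- A single edge is a fixed point, so further iterations do not hurt.
  have hk' : iteration^[k] (iteration^[i] (init T)) = [node τ []] := by
    rw [← Function.iterate_add_apply, add_comm, Function.iterate_add_apply, hk]
    exact Function.iterate_fixed rfl i
  have h1 := countOutside_add_one_le (TopTree.depthLE α i) hk'
  have h2 : ((labelsForest (iteration^[i] (init T))).map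
      fun c => c.countOutside (TopTree.depthLE α i) + 1) =
      (labelsForest (iteration^[i] (init T))).map fun _ => 1 :=
    List.map_congr_left fun c hc => by
      rw [TopTree.countOutside_eq_zero (forall_mem_labelsForest_iterate_init T i c hc)]
  rw [h2, List.map_const', List.sum_replicate, smul_eq_mul, mul_one, length_labelsForest] at h1
  have h3 := TopTree.card_subtrees_le (TopTree.subtrees_subset_depthLE (i := i)) τ
  omega

theorem dagSize_le_pow_add [Fintype α] (hα : 2 ≤ Fintype.card α) {T : OTree α} {τ : TopTree α}
    (hτ : IsTopTree T τ) (i : ℕ) :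
    (τ.dagSize : ℝ) ≤
      3 * ((Fintype.card α : ℝ) ^ (5 * 2 ^ i) + (7 / 8) ^ i * T.numNodes + 1) := by
  have h1 : (τ.dagSize : ℝ) ≤ 3 * τ.subtrees.card := by exact_mod_cast τ.dagSize_le
  have h2 : (τ.subtrees.card : ℝ) ≤
      (TopTree.depthLE α i).card + numNodesForest (iteration^[i] (init T)) := by
    exact_mod_cast card_subtrees_le_card_depthLE_add hτ i
  have h3 : ((TopTree.depthLE α i).card : ℝ) ≤ (Fintype.card α : ℝ) ^ (5 * 2 ^ i) := by
    exact_mod_cast TopTree.card_depthLE_le hα i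
  have h4 := numNodesForest_iterate_le (init T) i
  have h5 : (7 / 8 : ℝ) ^ i * numNodesForest (init T) ≤ (7 / 8) ^ i * T.numNodes := by
    gcongr
    have := numNodesForest_init_add_one T
    omega
  linarith

/-! ### The choice of the number of iterations -/

/-- This is where the exponent comes from: it has to be at most `logb 2 (8 / 7) = 0.1926…`. -/
theorem seven_eighths_le_two_rpow : (7 / 8 : ℝ) ≤ 2 ^ (-(0.19 : ℝ)) := by
  have h : (2 : ℝ) ^ (0.19 : ℝ) ≤ 8 / 7 := by
    refine le_of_pow_le_pow_left₀ (n := 100) (by norm_num) (by norm_num) ?_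
    rw [← Real.rpow_mul_natCast (by norm_num)]
    norm_num
  rw [Real.rpow_neg (by norm_num)]
  calc (7 / 8 : ℝ) = (8 / 7)⁻¹ := by norm_num
    _ ≤ _ := by gcongr

theorem seven_eighths_pow_le {x : ℝ} (hx : 0 < x) {i : ℕ} (hi : x < 20 * 2 ^ i) :
    (7 / 8 : ℝ) ^ i ≤ 20 / x ^ (0.19 : ℝ) := by
  have hx' : 0 < x ^ (0.19 : ℝ) := Real.rpow_pos_of_pos hx _
  have h1 : (7 / 8 : ℝ) ^ i ≤ ((2 : ℝ) ^ i) ^ (-(0.19 : ℝ)) := calc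
    (7 / 8 : ℝ) ^ i ≤ (2 ^ (-(0.19 : ℝ))) ^ i := by gcongr; exact seven_eighths_le_two_rpow
    _ = ((2 : ℝ) ^ i) ^ (-(0.19 : ℝ)) := (Real.rpow_pow_comm (by norm_num) _ _)
  have h2 : x ^ (0.19 : ℝ) ≤ 20 * ((2 : ℝ) ^ i) ^ (0.19 : ℝ) := calc
    x ^ (0.19 : ℝ) ≤ (20 * 2 ^ i) ^ (0.19 : ℝ) := by gcongr
    _ = 20 ^ (0.19 : ℝ) * ((2 : ℝ) ^ i) ^ (0.19 : ℝ) := Real.mul_rpow (by norm_num) (by positivity)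
    _ ≤ 20 ^ (1 : ℝ) * ((2 : ℝ) ^ i) ^ (0.19 : ℝ) := by gcongr <;> norm_num
    _ = _ := by rw [Real.rpow_one]
  refine h1.trans ?_
  rw [Real.rpow_neg (by positivity), inv_eq_one_div, div_le_div_iff₀ (by positivity) hx']
  linarith

theorem sqrt_le_div_logb_rpow {s n : ℝ} (hs : 2 ≤ s) (hn : 1 ≤ n) (hl : 1 ≤ Real.logb s n) :
    √n ≤ n / Real.logb s n ^ (0.19 : ℝ) := by
  have h1 : Real.logb s n ≤ n := by
    rw [Real.logb_le_iff_le_rpow (by linarith) (by linarith)]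
    calc n ≤ 2 ^ n := by
          have := one_add_mul_self_le_rpow_one_add (s := 1) (p := n) (by norm_num) hn
          norm_num at this
          linarith
      _ ≤ s ^ n := by gcongr
  rw [le_div_iff₀ (Real.rpow_pos_of_pos (by linarith) _)]
  calc √n * Real.logb s n ^ (0.19 : ℝ) ≤ √n * √n := by
        gcongr
        rw [Real.sqrt_eq_rpow]
        calc Real.logb s n ^ (0.19 : ℝ) ≤ Real.logb s n ^ (1 / 2 : ℝ) :=
              Real.rpow_le_rpow_of_exponent_le hl (by norm_num)
          _ ≤ n ^ (1 / 2 : ℝ) := by gcongr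
    _ = n := Real.mul_self_sqrt (by linarith)

end TopTreeConstruction

theorem theorem1 :
    ∃ C : ℝ, 0 < C ∧
      ∀ (A : Type*) [Fintype A] [DecidableEq A] (T : OTree A),
        2 ≤ Fintype.card A → 2 ≤ T.numNodes →
          ∃ τ : TopTree A, IsTopTree T τ ∧
            (τ.dagSize : ℝ) ≤
              C * ((T.numNodes : ℝ) /
                (Real.logb (Fintype.card A : ℝ) (T.numNodes : ℝ)) ^ (0.19 : ℝ)) := by
  refine ⟨66, by norm_num, fun A _ _ T hA hT => ?_⟩
  obtain ⟨τ, hτ⟩ := TopTreeConstruction.exists_isTopTree hT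
  refine ⟨τ, hτ, ?_⟩
  have hs : (2 : ℝ) ≤ Fintype.card A := by exact_mod_cast hA
  have hn : (2 : ℝ) ≤ T.numNodes := by exact_mod_cast hT
  have h6 : (τ.dagSize : ℝ) ≤ 6 * T.numNodes := by 
    exact_mod_cast TopTreeConstruction.dagSize_le_mul_numNodes hτ
  have hdag := TopTreeConstruction.dagSize_le_pow_add hA hτ
  generalize (T.numNodes : ℝ) = n at *
  generalize (Fintype.card A : ℝ) = s at *
  generalize (τ.dagSize : ℝ) = D at *
  set l := Real.logb s n with hl
  have hl0 : 0 < l := Real.logb_pos (by linarith) (by linarith)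
  have hlp : 0 < l ^ (0.19 : ℝ) := Real.rpow_pos_of_pos hl0 _
  obtain hl10 | hl10 := lt_or_ge l 10
  · have h1 : l ^ (0.19 : ℝ) ≤ 10 := calc
      l ^ (0.19 : ℝ) ≤ 10 ^ (0.19 : ℝ) := by gcongr
      _ ≤ 10 ^ (1 : ℝ) := by gcongr <;> norm_num
      _ = 10 := Real.rpow_one _
    have h2 : n ≤ 10 * (n / l ^ (0.19 : ℝ)) := by
      rw [← mul_div_assoc, le_div_iff₀ hlp]
      nlinarith
    linarith [show 0 ≤ n / l ^ (0.19 : ℝ) by positivity]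
  · -- After `i` iterations with `2 ^ i ≤ l / 10 < 2 ^ (i + 1)`, there are at most
    -- `s ^ (l / 2) = √n` different clusters.
    obtain ⟨i, hi1, hi2⟩ := exists_nat_pow_near (show 1 ≤ l / 10 by linarith) one_lt_two
    have h1 : s ^ (5 * 2 ^ i) ≤ √n := by
      rw [Real.sqrt_eq_rpow, ← Real.rpow_logb (b := s) (x := n) (by linarith) (by linarith)
        (by linarith), ← Real.rpow_mul (by linarith), ← Real.rpow_natCast]
      refine Real.rpow_le_rpow_of_exponent_le (by linarith) ?_
      push_cast
      linarith
    have h2 : (7 / 8 : ℝ) ^ i * n ≤ 20 * (n / l ^ (0.19 : ℝ)) := by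
      have := TopTreeConstruction.seven_eighths_pow_le hl0 (i := i)
        (by rw [pow_succ] at hi2; linarith)
      calc (7 / 8 : ℝ) ^ i * n ≤ 20 / l ^ (0.19 : ℝ) * n := by gcongr
        _ = _ := by ring
    have h3 : √n ≤ n / l ^ (0.19 : ℝ) :=
      TopTreeConstruction.sqrt_le_div_logb_rpow hs (by linarith) (by linarith)
    have h4 : 1 ≤ √n := Real.one_le_sqrt.2 (by linarith)
    linarith [hdag i]
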